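/- Let $X$ be a Polish space with its Borel $\sigma$-algebra, let $P$ be a probability measure on $X$, and let $\mathcal P(X)$ be the set of Borel probability measures on $X$ with the weak topology and the Borel $\sigma$-algebra $\mathcal B^w$ of that topology. For $n\ge 1$ and $X^n=(X_1,\dots,X_n)\sim P^{\otimes n}$ let $\mathsf L_{X^n}=\frac1n\sum_{i=1}^n\delta_{X_i}$ be the empirical measure. For $Q\in\mathcal P(X)$ let $D(Q\|P)=\int\log\frac{dQ}{dP}\,dQ$ if $Q\ll P$, and $D(Q\|P)=+\infty$ otherwise. **Sanov's Theorem.** The laws of $\mathsf L_{X^n}$ satisfy the large deviation principle in $\mathcal P(X)$ with the good, convex rate function $D(\cdot\|P)$. That is: 1. for every $\Gamma\in\mathcal B^w$, with closure $\overline\Gamma$ and interior $\Gamma^o$ in the weak topology, $$\inf_{Q\in\overline\Gamma}D(Q\|P)\le\liminf_{n\to\infty}-\frac1n\log\mathbb P\{\mathsf L_{X^n}\in\Gamma\}\le\limsup_{n\to\infty}-\frac1n\log\mathbb P\{\mathsf L_{X^n}\in\Gamma\}\le\inf_{Q\in\Gamma^o}D(Q\|P),$$ where $\inf\emptyset=+\infty$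 and $-\log 0=+\infty$; 2. $Q\mapsto D(Q\|P)$ is lower semicontinuous on $\mathcal P(X)$ and for every finite $c\ge 0$ the set $\{Q\in\mathcal P(X):D(Q\|P)\le c\}$ is compact in the weak topology; 3. $D(aQ_0+bQ_1\|P)\le a\,D(Q_0\|P)+b\,D(Q_1\|P)$ for all $Q_0,Q_1\in\mathcal P(X)$ and $a,b\ge 0$ with $a+b=1$ (with $0\cdot\infty=0$). -/

import Mathlib

open MeasureTheory Filter Topology
open scoped ENNReal NNReal

namespace Sanov

/-- A rate function on a topological space is a lower semicontinuous function with values in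
`[0, ∞]`; it is good if all its sublevel sets at finite levels are compact. -/
structure IsGoodRateFunction {E : Type*} [TopologicalSpace E] (I : E → ℝ≥0∞) : Prop where
  lowerSemicontinuous : LowerSemicontinuous I
  isCompact_sublevel : ∀ c : ℝ≥0, IsCompact {x | I x ≤ (c : ℝ≥0∞)}

/-- `-(1/n) log p` as an extended real number, equal to `+∞` when `p = 0`. -/
noncomputable def expRate (n : ℕ+) (p : ℝ≥0∞) : EReal :=
  -(ENNReal.log p / ((n : ℕ) : EReal))

/-- The large deviation principle (with speed `n`) for a sequence of measures on the Borel
`σ`-algebra of a topological space `E`, with rate function `I`. Infima over the empty set are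
`+∞`. -/
def SatisfiesLDP {E : Type*} [TopologicalSpace E] (ν : ℕ+ → Measure[borel E] E)
    (I : E → ℝ≥0∞) : Prop :=
  ∀ Γ : Set E, MeasurableSet[borel E] Γ →
    (⨅ x ∈ closure Γ, (I x : EReal)) ≤ liminf (fun n : ℕ+ => expRate n (ν n Γ)) atTop ∧
    liminf (fun n : ℕ+ => expRate n (ν n Γ)) atTop
      ≤ limsup (fun n : ℕ+ => expRate n (ν n Γ)) atTop ∧
    limsup (fun n : ℕ+ => expRate n (ν n Γ)) atTop ≤ ⨅ x ∈ interior Γ, (I x : EReal)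

/-- Convexity of an extended-real function on the set of probability measures: its value at the
mixture `a Q₀ + b Q₁` is at most the mixture of its values. -/
def IsConvexOnProbabilityMeasures {X : Type*} [MeasurableSpace X]
    (I : ProbabilityMeasure X → ℝ≥0∞) : Prop :=
  ∀ (Q₀ Q₁ Q : ProbabilityMeasure X) (a b : ℝ≥0), a + b = 1 →
    (Q : Measure X) = a • (Q₀ : Measure X) + b • (Q₁ : Measure X) →
    I Q ≤ a * I Q₀ + b * I Q₁

/-- The relative entropy `D(Q‖P)`, in nats. -/
noncomputable def relEntropy {X : Type*} [MeasurableSpace X] (Q P : ProbabilityMeasure X) :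
    ℝ≥0∞ :=
  InformationTheory.klDiv (Q : Measure X) (P : Measure X)

/-- The empirical measure `(1/n) ∑ᵢ δ_{xᵢ}` of a sample `x` of size `n ≥ 1`. -/
noncomputable def empiricalMeasure {X : Type*} [MeasurableSpace X] (n : ℕ+)
    (x : Fin n → X) : ProbabilityMeasure X :=
  ⟨((n : ℕ) : ℝ≥0∞)⁻¹ • ∑ i, Measure.dirac (x i), ⟨by
    simp only [Measure.smul_apply, Measure.coe_finsetSum, Finset.sum_apply, measure_univ,
      Finset.sum_const, Finset.card_univ, Fintype.card_fin, nsmul_eq_mul, mul_one, smul_eq_mul]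
    exact ENNReal.inv_mul_cancel (by simp) (by simp)⟩⟩

section

variable {X : Type*} [TopologicalSpace X] [MeasurableSpace X] [BorelSpace X]

/-- The law of the empirical measure of a sample from `P^{⊗n}`, as a measure on the Borel
`σ`-algebra of the weak topology on the set of probability measures. -/
noncomputable def empiricalLaw (P : ProbabilityMeasure X) (n : ℕ+) :
    Measure[borel (ProbabilityMeasure X)] (ProbabilityMeasure X) :=
  @Measure.map (Fin n → X) (ProbabilityMeasure X) MeasurableSpace.pi
    (borel (ProbabilityMeasure X)) (empiricalMeasure n)
    (Measure.pi fun _ : Fin n => (P : Measure X))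

/-- The empirical measure depends continuously on the sample. -/
theorem continuous_empiricalMeasure (n : ℕ+) :
    Continuous (empiricalMeasure n : (Fin n → X) → ProbabilityMeasure X) := by
  have key : ∀ (f : BoundedContinuousFunction X ℝ) (x : Fin n → X),
      ∫ ω, f ω ∂(empiricalMeasure n x : Measure X) = ((n : ℕ) : ℝ)⁻¹ * ∑ i, f (x i) := by
    intro f x
    have h1 : (empiricalMeasure n x : Measure X)
        = ((n : ℕ) : ℝ≥0∞)⁻¹ • ∑ i, Measure.dirac (x i) := rfl
    rw [h1, integral_smul_measure, integral_finsetSum_measure]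
    · simp [integral_dirac' _ _ f.continuous.stronglyMeasurable]
    · intro i _
      exact f.integrable _
  rw [continuous_iff_continuousAt]
  intro x
  refine ProbabilityMeasure.tendsto_iff_forall_integral_tendsto.mpr fun f => ?_
  simp only [key]
  have hc : Continuous fun y : Fin n → X => ((n : ℕ) : ℝ)⁻¹ * ∑ i, f (y i) := by fun_prop
  exact hc.tendsto x

/-- Over a second countable space the empirical measure is a Borel random element, so that
`empiricalLaw` is a genuine push-forward. -/
theorem measurable_empiricalMeasure [SecondCountableTopology X] (n : ℕ+) :
    @Measurable (Fin n → X) (ProbabilityMeasure X) MeasurableSpace.pi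
      (borel (ProbabilityMeasure X)) (empiricalMeasure n) := by
  let _ : MeasurableSpace (ProbabilityMeasure X) := borel (ProbabilityMeasure X)
  have : BorelSpace (ProbabilityMeasure X) := ⟨rfl⟩
  exact (continuous_empiricalMeasure n).measurable

theorem empiricalLaw_apply [SecondCountableTopology X] (P : ProbabilityMeasure X) (n : ℕ+)
    {Γ : Set (ProbabilityMeasure X)} (hΓ : MeasurableSet[borel (ProbabilityMeasure X)] Γ) :
    empiricalLaw P n Γ
      = Measure.pi (fun _ : Fin n => (P : Measure X)) (empiricalMeasure n ⁻¹' Γ) :=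
  @Measure.map_apply _ _ _ (borel (ProbabilityMeasure X)) _ _ (measurable_empiricalMeasure n) _ hΓ

end

end Sanov

/-! Apart from the lower bound, everything rests on the dual formula D(Q‖P) = sup_g (∫ g dQ - ∫ (e^g
- 1) dP) over bounded continuous g (`relEntropy_eq_iSup`). Using ∫ (e^g - 1) dP instead of log ∫ e^g
dP makes it the pointwise Legendre transform of `klFun`, integrated. For fixed g the functional is
weakly continuous and affine in Q, so its supremum is lower semicontinuous and convex.

Upper bound: if D(Q‖P) > c, some g puts Q in the open half-space where the functional exceeds c, and
Chernoff's inequality gives this half-space probability at most e^{-nc}. Finitely many half-spaces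
cover a compact part of a closed set; exponential tightness controls the rest. The test functions
t·1_{Kᶜ}, with K compact and P(Kᶜ) ≤ e^{-t}, give both this tightness and, through Prokhorov's
theorem, compactness of the entropy sublevels.

Lower bound: let U be a neighbourhood of Q and c > D(Q‖P). By the law of large numbers, with
Q^{⊗n}-probability tending to 1, the empirical measure is in U and the average log-likelihood ratio
is at most c. There dQ^{⊗n}/dP^{⊗n} ≤ e^{nc}, so the P^{⊗n}-probability is eventually at least
e^{-nc}/2. -/

namespace Sanov

open Set InformationTheory

/-! ### Duality with bounded measurable test functions -/

section Variational

variable {X : Type*} [MeasurableSpace X]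

/-- The functional `∫ g dμ - ∫ (exp g - 1) dν`, whose supremum over bounded functions `g` is the
relative entropy of probability measures. -/
noncomputable def dualFunctional (μ ν : Measure X) (g : X → ℝ) : ℝ :=
  ∫ x, g x ∂μ - ∫ x, (Real.exp (g x) - 1) ∂ν

/-- Fenchel–Young inequality: for s > 0 it is 1 + u ≤ e^u at u = y - log s. -/
theorem mul_sub_exp_sub_one_le_klFun {s : ℝ} (hs : 0 ≤ s) (y : ℝ) :
    s * y - (Real.exp y - 1) ≤ klFun s := by
  rw [klFun_apply]
  rcases hs.eq_or_lt with rfl | hs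
  · simp [(Real.exp_pos y).le]
  · have h := Real.add_one_le_exp (y - Real.log s)
    rw [Real.exp_sub, Real.exp_log hs, le_div_iff₀ hs] at h
    linarith

theorem integrable_of_abs_le {μ : Measure X} [IsFiniteMeasure μ] {g : X → ℝ} (hg : Measurable g)
    {C : ℝ} (hC : ∀ x, |g x| ≤ C) : Integrable g μ :=
  Integrable.of_bound hg.aestronglyMeasurable C (ae_of_all _ hC)

theorem integrable_exp_sub_one {ν : Measure X} [IsFiniteMeasure ν] {g : X → ℝ}
    (hg : Measurable g) {C : ℝ} (hC : ∀ x, |g x| ≤ C) :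
    Integrable (fun x => Real.exp (g x) - 1) ν := by
  refine (integrable_of_abs_le (C := Real.exp C) (by fun_prop) fun x => ?_).sub
    (integrable_const 1)
  rw [abs_of_pos (Real.exp_pos _)]
  exact Real.exp_le_exp.2 ((le_abs_self _).trans (hC x))

theorem integrable_toReal_rnDeriv_mul {μ ν : Measure X} [IsFiniteMeasure μ] {g : X → ℝ}
    (hg : Measurable g) {C : ℝ} (hC : ∀ x, |g x| ≤ C) :
    Integrable (fun x => (μ.rnDeriv ν x).toReal * g x) ν :=
  Measure.integrable_toReal_rnDeriv.mul_bdd hg.aestronglyMeasurable (ae_of_all _ hC)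

theorem dualFunctional_eq_integral {μ ν : Measure X} [IsFiniteMeasure μ] [IsFiniteMeasure ν]
    (hμν : μ ≪ ν) {g : X → ℝ} (hg : Measurable g) {C : ℝ} (hC : ∀ x, |g x| ≤ C) :
    dualFunctional μ ν g
      = ∫ x, ((μ.rnDeriv ν x).toReal * g x - (Real.exp (g x) - 1)) ∂ν := by
  rw [integral_sub (integrable_toReal_rnDeriv_mul hg hC) (integrable_exp_sub_one hg hC),
    dualFunctional, ← integral_rnDeriv_smul hμν]
  rfl

theorem ofReal_dualFunctional_le_klDiv {μ ν : Measure X} [IsFiniteMeasure μ] [IsFiniteMeasure ν]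
    {g : X → ℝ} (hg : Measurable g) {C : ℝ} (hC : ∀ x, |g x| ≤ C) :
    ENNReal.ofReal (dualFunctional μ ν g) ≤ klDiv μ ν := by
  by_cases h : klDiv μ ν = ∞
  · simp [h]
  obtain ⟨hac, hint⟩ := klDiv_ne_top_iff.1 h
  rw [klDiv_eq_integral_klFun, if_pos ⟨hac, hint⟩, dualFunctional_eq_integral hac hg hC]
  refine ENNReal.ofReal_le_ofReal (integral_mono ?_ ?_ fun x => ?_)
  · exact (integrable_toReal_rnDeriv_mul hg hC).sub (integrable_exp_sub_one hg hC)
  · exact (integrable_klFun_rnDeriv_iff hac).2 hint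
  · exact mul_sub_exp_sub_one_le_klFun ENNReal.toReal_nonneg _

/-- The logarithm truncated to `[-k, k]`, with value `-k` at `0`. -/
noncomputable def truncLog (k : ℕ) (s : ℝ) : ℝ :=
  if s = 0 then -k else max (-k) (min k (Real.log s))

theorem measurable_truncLog (k : ℕ) : Measurable (truncLog k) :=
  Measurable.ite (measurableSet_singleton 0) measurable_const (by fun_prop)

theorem abs_truncLog_le (k : ℕ) (s : ℝ) : |truncLog k s| ≤ k := by
  have hk : (0 : ℝ) ≤ k := k.cast_nonneg
  rw [abs_le, truncLog]
  split_ifs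
  · exact ⟨le_rfl, by linarith⟩
  · exact ⟨le_max_left _ _, max_le (by linarith) (min_le_left _ _)⟩

/-- The truncated value y lies between 0 and log s when s > 0, so y e^y ≤ s y, while e^y - 1 ≤ y e^y
always. This sign is what allows Fatou's lemma. -/
theorem mul_truncLog_sub_nonneg (k : ℕ) {s : ℝ} (hs : 0 ≤ s) :
    0 ≤ s * truncLog k s - (Real.exp (truncLog k s) - 1) := by
  have hk : (0 : ℝ) ≤ k := k.cast_nonneg
  rw [truncLog]
  split_ifs with h
  · simp [h]
  have hs : 0 < s := lt_of_le_of_ne hs (Ne.symm h)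
  set y := max (-(k : ℝ)) (min k (Real.log s)) with hy
  have h1 : Real.exp y * y ≤ s * y := by
    rcases le_total 0 (Real.log s) with hl | hl
    · have hy0 : 0 ≤ y := le_max_of_le_right (le_min hk hl)
      have hyl : y ≤ Real.log s := max_le (by linarith) (min_le_right _ _)
      exact mul_le_mul_of_nonneg_right ((Real.le_log_iff_exp_le hs).1 hyl) hy0
    · have hy0 : y ≤ 0 := max_le (by linarith) ((min_le_right _ _).trans hl)
      have hyl : Real.log s ≤ y := le_max_of_le_right (le_min (by linarith) le_rfl)
      exact mul_le_mul_of_nonpos_right ((Real.log_le_iff_le_exp hs).1 hyl) hy0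
  have h2 := Real.add_one_le_exp (-y)
  have h3 : Real.exp y * Real.exp (-y) = 1 := by rw [← Real.exp_add]; simp
  nlinarith [Real.exp_pos y]

theorem tendsto_mul_truncLog_sub {s : ℝ} (hs : 0 ≤ s) :
    Tendsto (fun k : ℕ => s * truncLog k s - (Real.exp (truncLog k s) - 1)) atTop
      (𝓝 (klFun s)) := by
  rw [klFun_apply]
  rcases hs.eq_or_lt with rfl | hs
  · have h : Tendsto (fun k : ℕ => Real.exp (-(k : ℝ))) atTop (𝓝 0) :=
      Real.tendsto_exp_neg_atTop_nhds_zero.comp tendsto_natCast_atTop_atTop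
    simpa [truncLog] using h.const_sub 1
  · refine tendsto_const_nhds.congr' ?_
    filter_upwards [eventually_ge_atTop ⌈|Real.log s|⌉₊] with k hk
    have hk : |Real.log s| ≤ k := Nat.ceil_le.1 hk
    rw [abs_le] at hk
    rw [truncLog, if_neg hs.ne', min_eq_right hk.2, max_eq_right hk.1, Real.exp_log hs]
    ring

/-- The optimal g is log dμ/dν, possibly unbounded; its truncations suffice by Fatou's lemma.
Without absolute continuity, a large multiple of the indicator of a ν-null set charged by μ works.
-/
theorem exists_lt_ofReal_dualFunctional {μ ν : Measure X} [IsFiniteMeasure μ] [IsFiniteMeasure ν]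
    {c : ℝ≥0∞} (hc : c < klDiv μ ν) :
    ∃ g : X → ℝ, Measurable g ∧ (∃ C, ∀ x, |g x| ≤ C) ∧
      c < ENNReal.ofReal (dualFunctional μ ν g) := by
  by_cases hac : μ ≪ ν
  · rw [klDiv_eq_lintegral_klFun_of_ac hac] at hc
    set f : X → ℝ := fun x => (μ.rnDeriv ν x).toReal with hf
    have hfm : Measurable f := by fun_prop
    have hlim : ∫⁻ x, ENNReal.ofReal (klFun (f x)) ∂ν ≤ liminf (fun k : ℕ =>
        ∫⁻ x, ENNReal.ofReal (f x * truncLog k (f x) - (Real.exp (truncLog k (f x)) - 1)) ∂ν)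
        atTop := by
      refine le_trans (le_of_eq ?_) (lintegral_liminf_le fun k => ?_)
      · refine lintegral_congr fun x => ?_
        exact ((ENNReal.continuous_ofReal.tendsto _).comp
          (tendsto_mul_truncLog_sub ENNReal.toReal_nonneg)).liminf_eq.symm
      · have := measurable_truncLog k
        fun_prop
    obtain ⟨k, hk⟩ := (eventually_lt_of_lt_liminf (hc.trans_le hlim)).exists
    have hm : Measurable fun x => truncLog k (f x) := (measurable_truncLog k).comp hfm
    have hb : ∀ x, |truncLog k (f x)| ≤ k := fun x => abs_truncLog_le k _
    refine ⟨fun x => truncLog k (f x), hm, ⟨k, hb⟩, ?_⟩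
    rwa [dualFunctional_eq_integral hac hm hb, ofReal_integral_eq_lintegral_ofReal]
    · exact (integrable_toReal_rnDeriv_mul hm hb).sub (integrable_exp_sub_one hm hb)
    · exact ae_of_all _ fun x => mul_truncLog_sub_nonneg k ENNReal.toReal_nonneg
  · have hct : c ≠ ∞ := (hc.trans_le le_top).ne
    obtain ⟨A, hA, hν, hμ⟩ : ∃ A, MeasurableSet A ∧ ν A = 0 ∧ μ A ≠ 0 := by
      by_contra! h
      exact hac (Measure.AbsolutelyContinuous.mk fun s hs h0 => h s hs h0)
    have hpos : 0 < μ.real A := ENNReal.toReal_pos hμ (measure_ne_top _ _)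
    set t := (c.toReal + 1) / μ.real A with ht
    have hF : dualFunctional μ ν (A.indicator fun _ => t) = c.toReal + 1 := by
      have h1 : (fun x => Real.exp (A.indicator (fun _ => t) x) - 1) =ᵐ[ν] 0 := by
        have : ∀ᵐ x ∂ν, x ∉ A := measure_eq_zero_iff_ae_notMem.1 hν
        filter_upwards [this] with x hx
        simp [hx]
      rw [dualFunctional, integral_congr_ae h1, integral_indicator_const _ hA]
      simp only [Pi.zero_apply, integral_zero, sub_zero, smul_eq_mul, ht]
      field_simp
    refine ⟨A.indicator fun _ => t, measurable_const.indicator hA, ⟨|t|, fun x => ?_⟩, ?_⟩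
    · by_cases hx : x ∈ A <;> simp [hx]
    · rw [hF, ENNReal.lt_ofReal_iff_toReal_lt hct]
      linarith

end Variational

/-! ### Continuous test functions, semicontinuity and convexity -/

section Topological

variable {X : Type*} [TopologicalSpace X] [MeasurableSpace X] [BorelSpace X]

theorem abs_exp_sub_exp_le {C a b : ℝ} (ha : |a| ≤ C) (hb : |b| ≤ C) :
    |Real.exp a - Real.exp b| ≤ Real.exp C * |a - b| := by
  wlog hab : b ≤ a generalizing a b
  · rw [abs_sub_comm, abs_sub_comm a]
    exact this hb ha (le_of_not_ge hab)
  rw [abs_of_nonneg (sub_nonneg.2 (Real.exp_le_exp.2 hab)), abs_of_nonneg (sub_nonneg.2 hab)]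
  have h1 := Real.add_one_le_exp (b - a)
  have h2 : Real.exp b = Real.exp a * Real.exp (b - a) := by rw [← Real.exp_add]; ring_nf
  have h3 : Real.exp a ≤ Real.exp C := Real.exp_le_exp.2 ((le_abs_self a).trans ha)
  nlinarith [Real.exp_pos a]

/-- Approximate g in L¹(μ + ν) by a continuous function and clip it to [-C, C]: clipping does not
increase the distance to g, and exp is e^C-Lipschitz on that interval. -/
theorem exists_boundedContinuous_dualFunctional_gt [NormalSpace X] {μ ν : Measure X}
    [IsFiniteMeasure μ] [IsFiniteMeasure ν] [(μ + ν).WeaklyRegular] {g : X → ℝ}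
    (hg : Measurable g) {C : ℝ} (hC : ∀ x, |g x| ≤ C) {c : ℝ} (hc : c < dualFunctional μ ν g) :
    ∃ h : BoundedContinuousFunction X ℝ, c < dualFunctional μ ν h := by
  wlog hC0 : 0 ≤ C generalizing C
  · exact this (C := |C|) (fun x => (hC x).trans (le_abs_self C)) (abs_nonneg C)
  -- An L¹ error δ changes the functional by at most (1 + e^C) δ, here half of the available gap.
  set K := 1 + Real.exp C with hK
  have hKpos : 0 < K := by positivity
  set δ := (dualFunctional μ ν g - c) / (2 * K) with hδ
  have hδpos : 0 < δ := div_pos (sub_pos.2 hc) (by positivity)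
  obtain ⟨h₀, h₀le, -⟩ := (integrable_of_abs_le (μ := μ + ν) hg
    hC).exists_boundedContinuous_integral_sub_le hδpos
  let h : BoundedContinuousFunction X ℝ := BoundedContinuousFunction.ofNormedAddCommGroup
    (fun x => max (-C) (min C (h₀ x))) (by fun_prop) C
    (fun x => abs_le.2 ⟨le_max_left _ _, max_le (by linarith) (min_le_left _ _)⟩)
  have hhC : ∀ x, |h x| ≤ C := fun x =>
    abs_le.2 ⟨le_max_left _ _, max_le (by linarith) (min_le_left _ _)⟩
  have hhm : Measurable h := h.continuous.measurable
  have hclose : ∀ x, |g x - h x| ≤ |g x - h₀ x| := by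
    intro x
    have hgx := abs_le.1 (hC x)
    have : g x = max (-C) (min C (g x)) := by
      rw [min_eq_right hgx.2, max_eq_right hgx.1]
    change |g x - max (-C) (min C (h₀ x))| ≤ _
    conv_lhs => rw [this]
    refine (abs_max_sub_max_le_max _ _ _ _).trans ?_
    simp only [sub_self, abs_zero]
    refine max_le (abs_nonneg _) ((abs_min_sub_min_le_max _ _ _ _).trans ?_)
    simp
  have hi : ∀ ρ : Measure X, IsFiniteMeasure ρ → Integrable (fun x => |g x - h x|) ρ := fun ρ _ =>
    ((integrable_of_abs_le hg hC).sub (integrable_of_abs_le hhm hhC)).abs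
  have htot : ∫ x, |g x - h x| ∂μ + ∫ x, |g x - h x| ∂ν ≤ δ := by
    rw [← integral_add_measure (hi μ inferInstance) (hi ν inferInstance)]
    refine le_trans (integral_mono (hi _ inferInstance) ?_ hclose) h₀le
    exact ((integrable_of_abs_le hg hC).sub (h₀.integrable _)).norm
  have hμ : ∫ x, g x ∂μ - ∫ x, h x ∂μ ≤ ∫ x, |g x - h x| ∂μ := by
    rw [← integral_sub (integrable_of_abs_le hg hC) (integrable_of_abs_le hhm hhC)]
    exact (le_abs_self _).trans abs_integral_le_integral_abs
  have hν : ∫ x, (Real.exp (h x) - 1) ∂ν - ∫ x, (Real.exp (g x) - 1) ∂ν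
      ≤ Real.exp C * ∫ x, |g x - h x| ∂ν := by
    rw [← integral_sub (integrable_exp_sub_one hhm hhC) (integrable_exp_sub_one hg hC),
      ← integral_const_mul]
    refine integral_mono ((integrable_exp_sub_one hhm hhC).sub (integrable_exp_sub_one hg hC))
      ((hi ν inferInstance).const_mul _) fun x => ?_
    have := (le_abs_self _).trans (abs_exp_sub_exp_le (hhC x) (hC x))
    rw [abs_sub_comm (h x)] at this
    simpa using this
  have hμ0 : 0 ≤ ∫ x, |g x - h x| ∂μ := integral_nonneg fun x => abs_nonneg _
  have hν0 : 0 ≤ ∫ x, |g x - h x| ∂ν := integral_nonneg fun x => abs_nonneg _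
  have hKδ : K * δ = (dualFunctional μ ν g - c) / 2 := by rw [hδ]; field_simp
  refine ⟨h, ?_⟩
  have hsum : dualFunctional μ ν g - dualFunctional μ ν h ≤ K * δ := by
    simp only [dualFunctional]
    nlinarith [Real.exp_pos C]
  linarith

/-- The variational formula for the relative entropy. -/
theorem relEntropy_eq_iSup [PolishSpace X] (Q P : ProbabilityMeasure X) :
    relEntropy Q P = ⨆ g : BoundedContinuousFunction X ℝ,
      ENNReal.ofReal (dualFunctional (Q : Measure X) (P : Measure X) g) := by
  refine le_antisymm (le_of_forall_lt fun c hc => ?_) (iSup_le fun g => ?_)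
  · obtain ⟨g, hg, ⟨C, hC⟩, hlt⟩ := exists_lt_ofReal_dualFunctional hc
    rw [ENNReal.lt_ofReal_iff_toReal_lt (hlt.trans ENNReal.ofReal_lt_top).ne] at hlt
    obtain ⟨h, hh⟩ := exists_boundedContinuous_dualFunctional_gt hg hC hlt
    rw [lt_iSup_iff]
    refine ⟨h, (ENNReal.lt_ofReal_iff_toReal_lt (hc.trans_le le_top).ne).2 hh⟩
  · exact ofReal_dualFunctional_le_klDiv g.continuous.measurable
      fun x => g.norm_coe_le_norm x

theorem continuous_dualFunctional (P : ProbabilityMeasure X) (g : BoundedContinuousFunction X ℝ) :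
    Continuous fun Q : ProbabilityMeasure X => dualFunctional (Q : Measure X) (P : Measure X) g :=
  (ProbabilityMeasure.continuous_integral_boundedContinuousFunction g).sub continuous_const

theorem lowerSemicontinuous_relEntropy [PolishSpace X] (P : ProbabilityMeasure X) :
    LowerSemicontinuous fun Q : ProbabilityMeasure X => relEntropy Q P := by
  simp only [relEntropy_eq_iSup]
  exact lowerSemicontinuous_iSup fun g =>
    (ENNReal.continuous_ofReal.comp (continuous_dualFunctional P g)).lowerSemicontinuous

theorem isConvexOnProbabilityMeasures_relEntropy [PolishSpace X] (P : ProbabilityMeasure X) :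
    IsConvexOnProbabilityMeasures fun Q : ProbabilityMeasure X => relEntropy Q P := by
  intro Q₀ Q₁ Q a b hab hQ
  change relEntropy Q P ≤ a * relEntropy Q₀ P + b * relEntropy Q₁ P
  rw [relEntropy_eq_iSup Q]
  refine iSup_le fun g => ?_
  have hF : dualFunctional (Q : Measure X) P g
      = a * dualFunctional (Q₀ : Measure X) P g + b * dualFunctional (Q₁ : Measure X) P g := by
    have hab' : (a : ℝ) + b = 1 := by exact_mod_cast hab
    simp only [dualFunctional]
    rw [hQ, integral_add_measure (g.integrable _) (g.integrable _), integral_smul_nnreal_measure,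
      integral_smul_nnreal_measure]
    simp only [NNReal.smul_def, smul_eq_mul]
    -- The P-term does not depend on the first measure; a + b = 1 splits it between the two parts.
    linear_combination (∫ x, (Real.exp (g x) - 1) ∂(P : Measure X)) * hab'
  have hle : ∀ R : ProbabilityMeasure X,
      ENNReal.ofReal (dualFunctional (R : Measure X) P g) ≤ relEntropy R P := fun R =>
    ofReal_dualFunctional_le_klDiv g.continuous.measurable fun x => g.norm_coe_le_norm x
  rw [hF]
  refine ENNReal.ofReal_add_le.trans ?_
  rw [ENNReal.ofReal_mul a.coe_nonneg, ENNReal.ofReal_mul b.coe_nonneg,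
    ENNReal.ofReal_coe_nnreal, ENNReal.ofReal_coe_nnreal]
  gcongr
  · exact hle Q₀
  · exact hle Q₁

end Topological

/-! ### Exponential Markov inequality for empirical averages -/

section Chernoff

variable {X : Type*} [MeasurableSpace X]

theorem integral_empiricalMeasure (n : ℕ+) (x : Fin n → X) {g : X → ℝ} (hg : Measurable g) :
    ∫ y, g y ∂(empiricalMeasure n x : Measure X) = (∑ i, g (x i)) / n := by
  have h : (empiricalMeasure n x : Measure X)
      = ((n : ℕ) : ℝ≥0∞)⁻¹ • ∑ i, Measure.dirac (x i) := rfl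
  rw [h, integral_smul_measure, integral_finsetSum_measure]
  · simp [integral_dirac' _ _ hg.stronglyMeasurable, div_eq_inv_mul]
  · exact fun i _ => integrable_dirac' hg.stronglyMeasurable (by simp)

theorem lintegral_pi_prod {ι : Type*} [Fintype ι] (μ : ι → Measure X)
    [∀ i, IsProbabilityMeasure (μ i)] {f : ι → X → ℝ≥0∞} (hf : ∀ i, Measurable (f i)) :
    ∫⁻ x, ∏ i, f i (x i) ∂(Measure.pi μ) = ∏ i, ∫⁻ y, f i y ∂(μ i) := by
  refine (ProbabilityTheory.lintegral_prod_eq_prod_lintegral_of_indepFun Finset.univ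
    (fun i (x : ι → X) => f i (x i)) (ProbabilityTheory.iIndepFun_pi fun i => (hf i).aemeasurable)
    fun i => (hf i).comp (measurable_pi_apply i)).trans ?_
  refine Finset.prod_congr rfl fun i _ => ?_
  exact (measurePreserving_eval μ i).lintegral_comp (hf i)

/-- Exponential Markov inequality and independence, with ∫ e^g dP = 1 + I weakened to e^I so that
the exponent matches `dualFunctional`. -/
theorem measure_le_integral_empiricalMeasure (P : ProbabilityMeasure X) (n : ℕ+) {g : X → ℝ}
    (hg : Measurable g) {C : ℝ} (hC : ∀ x, |g x| ≤ C) (a : ℝ) :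
    Measure.pi (fun _ : Fin n => (P : Measure X))
        {x | a ≤ ∫ y, g y ∂(empiricalMeasure n x : Measure X)}
      ≤ ENNReal.ofReal
          (Real.exp (-(n * (a - ∫ y, (Real.exp (g y) - 1) ∂(P : Measure X))))) := by
  set I := ∫ y, (Real.exp (g y) - 1) ∂(P : Measure X) with hI
  have hn : (0 : ℝ) < n := by exact_mod_cast n.pos
  have hexp : ∫⁻ y, ENNReal.ofReal (Real.exp (g y)) ∂(P : Measure X)
      ≤ ENNReal.ofReal (Real.exp I) := by
    have hint := integrable_exp_sub_one (ν := (P : Measure X)) hg hC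
    have hint' : Integrable (fun y => Real.exp (g y)) (P : Measure X) :=
      (integrable_add_iff_integrable_left (integrable_const (-1))).1 hint
    rw [← ofReal_integral_eq_lintegral_ofReal hint' (ae_of_all _ fun y => (Real.exp_pos _).le)]
    refine ENNReal.ofReal_le_ofReal (le_trans (le_of_eq ?_) (Real.add_one_le_exp I))
    rw [hI, integral_sub hint' (integrable_const 1)]
    simp
  calc Measure.pi (fun _ : Fin n => (P : Measure X))
        {x | a ≤ ∫ y, g y ∂(empiricalMeasure n x : Measure X)}
      ≤ ∫⁻ x, ENNReal.ofReal (Real.exp (-(n * a))) * ∏ i, ENNReal.ofReal (Real.exp (g (x i)))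
          ∂(Measure.pi fun _ : Fin n => (P : Measure X)) := by
        refine meas_le_lintegral₀ (Measurable.aemeasurable (by fun_prop)) fun x hx => ?_
        rw [mem_ofPred_eq, integral_empiricalMeasure n x hg, le_div_iff₀ hn] at hx
        rw [← ENNReal.ofReal_prod_of_nonneg fun i _ => (Real.exp_pos _).le,
          ← ENNReal.ofReal_mul (Real.exp_pos _).le, ← Real.exp_sum, ← Real.exp_add,
          ENNReal.one_le_ofReal, Real.one_le_exp_iff]
        linarith
    _ = ENNReal.ofReal (Real.exp (-(n * a)))
          * (∫⁻ y, ENNReal.ofReal (Real.exp (g y)) ∂(P : Measure X)) ^ (n : ℕ) := by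
        rw [lintegral_const_mul _ (by fun_prop),
          lintegral_pi_prod (fun _ => (P : Measure X))
            (f := fun _ y => ENNReal.ofReal (Real.exp (g y))) (fun _ => by fun_prop)]
        simp
    _ ≤ ENNReal.ofReal (Real.exp (-(n * a))) * ENNReal.ofReal (Real.exp I) ^ (n : ℕ) := by
        gcongr
    _ = ENNReal.ofReal (Real.exp (-(n * (a - I)))) := by
        rw [← ENNReal.ofReal_pow (Real.exp_pos _).le, ← Real.exp_nat_mul,
          ← ENNReal.ofReal_mul (Real.exp_pos _).le, ← Real.exp_add]
        congr 2
        ring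

end Chernoff

/-! ### Compact sublevels and exponential tightness -/

section Tightness

variable {X : Type*} [TopologicalSpace X] [MeasurableSpace X] [BorelSpace X] [PolishSpace X]

/-- Tightness of P gives K with P(Kᶜ) ≤ e^{-t}, and the integral is (e^t - 1) P(Kᶜ). -/
theorem exists_isCompact_integral_exp_indicator_le (P : ProbabilityMeasure X) (t : ℝ) :
    ∃ K : Set X, IsCompact K ∧
      ∫ x, (Real.exp (Kᶜ.indicator (fun _ => t) x) - 1) ∂(P : Measure X) ≤ 1 := by
  obtain ⟨K, hK, hKle⟩ := isTightMeasureSet_iff_exists_isCompact_measure_compl_le.1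
    (isTightMeasureSet_singleton (μ := (P : Measure X))) (ENNReal.ofReal (Real.exp (-t)))
    (ENNReal.ofReal_pos.2 (Real.exp_pos _))
  have hKP : (P : Measure X).real Kᶜ ≤ Real.exp (-t) :=
    ENNReal.toReal_le_of_le_ofReal (Real.exp_pos _).le (hKle _ rfl)
  refine ⟨K, hK, ?_⟩
  have h : (fun x => Real.exp (Kᶜ.indicator (fun _ => t) x) - 1)
      = Kᶜ.indicator fun _ => Real.exp t - 1 := by
    ext x
    by_cases hx : x ∈ Kᶜ
    · rw [indicator_of_mem hx, indicator_of_mem hx]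
    · rw [indicator_of_notMem hx, indicator_of_notMem hx, Real.exp_zero, sub_self]
  rw [h, integral_indicator_const _ hK.measurableSet.compl, smul_eq_mul]
  have h1 : Real.exp (-t) * Real.exp t = 1 := by rw [← Real.exp_add]; simp
  have h2 : 0 ≤ (P : Measure X).real Kᶜ := measureReal_nonneg
  nlinarith [Real.exp_pos t, mul_le_mul_of_nonneg_right hKP (Real.exp_pos t).le]

/-- The bound t Q(Kᶜ) ≤ C + l with t ≥ (l + 1)(C + l) forces Q(Kᶜ) ≤ 1/(l + 1), uniformly over S;
Prokhorov's theorem applies. -/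
theorem isCompact_closure_of_integral_indicator_le {S : Set (ProbabilityMeasure X)} {C : ℝ}
    (hS : ∀ l : ℕ, ∃ K : Set X, IsCompact K ∧ ∃ t : ℝ, (l + 1) * (C + l) ≤ t ∧ 0 < C + l ∧
      ∀ Q ∈ S, ∫ x, Kᶜ.indicator (fun _ => t) x ∂(Q : Measure X) ≤ C + l) :
    IsCompact (closure S) := by
  refine isCompact_closure_of_isTightMeasureSet
    (isTightMeasureSet_iff_exists_isCompact_measure_compl_le.2 fun ε hε => ?_)
  obtain ⟨r, hr, hrε⟩ := ENNReal.lt_iff_exists_nnreal_btwn.1 hε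
  obtain ⟨l, hl⟩ := exists_nat_one_div_lt (show (0 : ℝ) < r by exact_mod_cast hr)
  obtain ⟨K, hK, t, ht, hCl, hQ⟩ := hS l
  refine ⟨K, hK, ?_⟩
  rintro _ ⟨Q, hQS, rfl⟩
  refine le_trans ?_ hrε.le
  have h := hQ Q hQS
  rw [integral_indicator_const _ hK.measurableSet.compl, smul_eq_mul] at h
  have hreal : (Q : Measure X).real Kᶜ ≤ r := by
    refine le_trans ?_ hl.le
    rw [le_div_iff₀ (by positivity)]
    have h0 : 0 ≤ (Q : Measure X).real Kᶜ := measureReal_nonneg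
    have := mul_le_mul_of_nonneg_left ht h0
    refine le_of_mul_le_mul_right ?_ hCl
    linarith
  rw [← ENNReal.ofReal_toReal (measure_ne_top (Q : Measure X) Kᶜ)]
  exact (ENNReal.ofReal_le_ofReal hreal).trans_eq (by simp)

theorem isCompact_relEntropy_le (P : ProbabilityMeasure X) (c : ℝ≥0) :
    IsCompact {Q : ProbabilityMeasure X | relEntropy Q P ≤ c} := by
  have hclosed : IsClosed {Q : ProbabilityMeasure X | relEntropy Q P ≤ c} :=
    (lowerSemicontinuous_relEntropy P).isClosed_preimage _
  rw [← hclosed.closure_eq]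
  -- Here c bounds the entropy and 1 bounds the exponential integral.
  refine isCompact_closure_of_integral_indicator_le (C := c + 1) fun l => ?_
  have hpos : (0 : ℝ) < c + 1 + l := by positivity
  obtain ⟨K, hK, hKle⟩ := exists_isCompact_integral_exp_indicator_le P ((l + 1) * (c + 1 + l))
  refine ⟨K, hK, _, le_rfl, hpos, fun Q hQ => ?_⟩
  have h := (ofReal_dualFunctional_le_klDiv (μ := (Q : Measure X)) (ν := (P : Measure X))
    (measurable_const.indicator hK.measurableSet.compl) fun x =>
      norm_indicator_le_norm_self (fun _ => ((l : ℝ) + 1) * (c + 1 + l)) x).trans hQ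
  rw [ENNReal.ofReal_le_iff_le_toReal ENNReal.coe_ne_top, ENNReal.coe_toReal,
    dualFunctional] at h
  have hl : (0 : ℝ) ≤ l := l.cast_nonneg
  linarith

/-- A union bound over the constraints defining T. In the level m + 1 + l, the 1 absorbs the
exponential integral and l makes the bounds summable: e^{-n(m+l)} ≤ 2^{-l} e^{-nm}, whence the
factor 2. -/
theorem exponentially_tight (P : ProbabilityMeasure X) {m : ℝ} (hm : 0 ≤ m) :
    ∃ S : Set (ProbabilityMeasure X), IsCompact S ∧ ∀ n : ℕ+,
      Measure.pi (fun _ : Fin n => (P : Measure X)) (empiricalMeasure n ⁻¹' Sᶜ)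
        ≤ 2 * ENNReal.ofReal (Real.exp (-(n * m))) := by
  choose K hK hKle using fun l : ℕ =>
    exists_isCompact_integral_exp_indicator_le P ((l + 1) * (m + 1 + l))
  set g : ℕ → X → ℝ := fun l => (K l)ᶜ.indicator fun _ => (l + 1) * (m + 1 + l) with hg
  have hgm : ∀ l, Measurable (g l) := fun l =>
    measurable_const.indicator (hK l).measurableSet.compl
  set T : Set (ProbabilityMeasure X) :=
    {Q | ∀ l : ℕ, ∫ x, g l x ∂(Q : Measure X) ≤ m + 1 + l} with hT
  refine ⟨closure T, ?_, fun n => ?_⟩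
  · exact isCompact_closure_of_integral_indicator_le (C := m + 1) fun l =>
      ⟨K l, hK l, _, le_rfl, by positivity, fun Q hQ => hQ l⟩
  have hn : (1 : ℝ) ≤ n := by exact_mod_cast n.pos
  have hsub : empiricalMeasure n ⁻¹' (closure T)ᶜ
      ⊆ ⋃ l : ℕ, {x | m + 1 + l ≤ ∫ y, g l y ∂(empiricalMeasure n x : Measure X)} := by
    intro x hx
    have : empiricalMeasure n x ∉ T := fun h => hx (subset_closure h)
    simp only [hT, mem_ofPred_eq, not_forall, not_le] at this
    obtain ⟨l, hl⟩ := this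
    exact mem_iUnion.2 ⟨l, hl.le⟩
  have hterm : ∀ l : ℕ, Measure.pi (fun _ : Fin n => (P : Measure X))
      {x | m + 1 + l ≤ ∫ y, g l y ∂(empiricalMeasure n x : Measure X)}
      ≤ 2⁻¹ ^ l * ENNReal.ofReal (Real.exp (-(n * m))) := by
    intro l
    refine (measure_le_integral_empiricalMeasure P n (hgm l)
      (fun x => norm_indicator_le_norm_self (fun _ => ((l : ℝ) + 1) * (m + 1 + l)) x) _).trans ?_
    have h2 : (2 : ℝ≥0∞)⁻¹ = ENNReal.ofReal 2⁻¹ := by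
      rw [ENNReal.ofReal_inv_of_pos two_pos]; simp
    rw [h2, ← ENNReal.ofReal_pow (by norm_num), ← ENNReal.ofReal_mul (by positivity)]
    refine ENNReal.ofReal_le_ofReal ?_
    have he : Real.exp (-1) ≤ 2⁻¹ := by
      rw [Real.exp_neg]
      exact inv_anti₀ two_pos (by linarith [Real.add_one_le_exp (1 : ℝ)])
    calc Real.exp (-(n * (m + 1 + l - ∫ y, (Real.exp (g l y) - 1) ∂(P : Measure X))))
        ≤ Real.exp (l * (-1) + -(n * m)) := by
          refine Real.exp_le_exp.2 ?_
          have h1 := hKle l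
          have hl : (0 : ℝ) ≤ l := l.cast_nonneg
          have h3 : (n : ℝ) * (m + l)
              ≤ n * (m + 1 + l - ∫ y, (Real.exp (g l y) - 1) ∂(P : Measure X)) :=
            mul_le_mul_of_nonneg_left (by linarith) (by linarith)
          nlinarith
      _ = Real.exp (-1) ^ l * Real.exp (-(n * m)) := by rw [Real.exp_add, Real.exp_nat_mul]
      _ ≤ 2⁻¹ ^ l * Real.exp (-(n * m)) := by gcongr
  calc Measure.pi (fun _ : Fin n => (P : Measure X)) (empiricalMeasure n ⁻¹' (closure T)ᶜ)
      ≤ ∑' l : ℕ, 2⁻¹ ^ l * ENNReal.ofReal (Real.exp (-(n * m))) :=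
        ((measure_mono hsub).trans (measure_iUnion_le _)).trans (ENNReal.tsum_le_tsum hterm)
    _ = 2 * ENNReal.ofReal (Real.exp (-(n * m))) := by
        rw [ENNReal.tsum_mul_right, ENNReal.tsum_geometric, ENNReal.one_sub_inv_two, inv_inv]

end Tightness

/-! ### Upper bound on closed sets -/

section UpperBound

variable {X : Type*} [TopologicalSpace X] [MeasurableSpace X] [BorelSpace X] [PolishSpace X]

theorem exists_lt_dualFunctional {Q P : ProbabilityMeasure X} {c : ℝ}
    (hc : (c : EReal) < (relEntropy Q P : EReal)) :
    ∃ g : BoundedContinuousFunction X ℝ, c < dualFunctional (Q : Measure X) P g := by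
  rcases lt_or_ge c 0 with h0 | h0
  · exact ⟨0, by simpa [dualFunctional] using h0⟩
  · have h : ENNReal.ofReal c < relEntropy Q P := by
      rw [← EReal.coe_ennreal_lt_coe_ennreal_iff, EReal.coe_ennreal_ofReal, max_eq_left h0]
      exact hc
    rw [relEntropy_eq_iSup, lt_iSup_iff] at h
    obtain ⟨g, hg⟩ := h
    exact ⟨g, (ENNReal.ofReal_lt_ofReal_iff_of_nonneg h0).1 hg⟩

theorem exists_measure_empiricalMeasure_le (P : ProbabilityMeasure X)
    {F : Set (ProbabilityMeasure X)} (hF : IsClosed F) {c : ℝ}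
    (hc : ∀ Q ∈ F, (c : EReal) < (relEntropy Q P : EReal)) :
    ∃ C : ℝ≥0, ∀ n : ℕ+,
      Measure.pi (fun _ : Fin n => (P : Measure X)) (empiricalMeasure n ⁻¹' F)
        ≤ C * ENNReal.ofReal (Real.exp (-(n * c))) := by
  -- Exponential tightness is available for nonnegative rates only, whereas c may be negative.
  obtain ⟨S, hS, hSle⟩ := exponentially_tight P (le_max_right c 0)
  have hcompact : ∃ C : ℝ≥0, ∀ n : ℕ+,
      Measure.pi (fun _ : Fin n => (P : Measure X)) (empiricalMeasure n ⁻¹' (S ∩ F))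
        ≤ C * ENNReal.ofReal (Real.exp (-(n * c))) := by
    refine (hS.inter_right hF).induction_on (p := fun A => ∃ C : ℝ≥0, ∀ n : ℕ+,
      Measure.pi (fun _ : Fin n => (P : Measure X)) (empiricalMeasure n ⁻¹' A)
        ≤ C * ENNReal.ofReal (Real.exp (-(n * c)))) ⟨0, by simp⟩ ?_ ?_ ?_
    · rintro A B hAB ⟨C, hC⟩
      exact ⟨C, fun n => (measure_mono (preimage_mono hAB)).trans (hC n)⟩
    · rintro A B ⟨C, hC⟩ ⟨D, hD⟩
      refine ⟨C + D, fun n => ?_⟩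
      rw [preimage_union, ENNReal.coe_add, add_mul]
      exact (measure_union_le _ _).trans (add_le_add (hC n) (hD n))
    · rintro Q ⟨-, hQ⟩
      obtain ⟨g, hg⟩ := exists_lt_dualFunctional (hc Q hQ)
      -- An open half-space around Q, with Chernoff constant 1.
      refine ⟨{R | c < dualFunctional (R : Measure X) P g}, mem_nhdsWithin_of_mem_nhds
        ((isOpen_lt continuous_const (continuous_dualFunctional P g)).mem_nhds hg), 1,
        fun n => ?_⟩
      refine (measure_mono ?_).trans ((measure_le_integral_empiricalMeasure P n
        g.continuous.measurable (fun x => g.norm_coe_le_norm x)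
        (c + ∫ y, (Real.exp (g y) - 1) ∂(P : Measure X))).trans_eq ?_)
      · intro x hx
        have hx : c < dualFunctional (empiricalMeasure n x : Measure X) P g := hx
        rw [dualFunctional] at hx
        rw [mem_ofPred_eq]
        linarith
      · simp
  obtain ⟨C, hC⟩ := hcompact
  refine ⟨C + 2, fun n => ?_⟩
  have hsub : empiricalMeasure n ⁻¹' F
      ⊆ empiricalMeasure n ⁻¹' (S ∩ F) ∪ empiricalMeasure n ⁻¹' Sᶜ := by
    intro x hx
    by_cases h : empiricalMeasure n x ∈ S
    · exact Or.inl ⟨h, hx⟩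
    · exact Or.inr h
  refine (measure_mono hsub).trans ((measure_union_le _ _).trans ?_)
  rw [ENNReal.coe_add, add_mul]
  refine add_le_add (hC n) ((hSle n).trans ?_)
  rw [ENNReal.coe_ofNat]
  gcongr
  exact le_max_left c 0

end UpperBound

/-! ### Exponential rates on the extended real line -/

section ExpRate

theorem expRate_anti (n : ℕ+) {p q : ℝ≥0∞} (h : p ≤ q) : expRate n q ≤ expRate n p := by
  rw [expRate, expRate, EReal.neg_le_neg_iff]
  exact EReal.div_le_div_right_of_nonneg (by positivity) (ENNReal.log_monotone h)

theorem expRate_ofReal_exp (n : ℕ+) (b : ℝ) :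
    expRate n (ENNReal.ofReal (Real.exp (-(n * b)))) = b := by
  have hn : ((n : ℕ) : ℝ) ≠ 0 := by exact_mod_cast n.ne_zero
  rw [expRate, ENNReal.log_ofReal_of_pos (Real.exp_pos _), Real.log_exp,
    ← EReal.coe_coe_eq_natCast, ← EReal.coe_div, ← EReal.coe_neg]
  congr 1
  field_simp

theorem expRate_mul_ofReal_exp (n : ℕ+) {C : ℝ} (hC : 0 < C) (b : ℝ) :
    expRate n (ENNReal.ofReal C * ENNReal.ofReal (Real.exp (-(n * b))))
      = ((b - Real.log C / n : ℝ) : EReal) := by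
  have hn : ((n : ℕ) : ℝ) ≠ 0 := by exact_mod_cast n.ne_zero
  rw [← expRate_ofReal_exp, ← ENNReal.ofReal_mul hC.le]
  congr 2
  nth_rewrite 1 [← Real.exp_log hC]
  rw [← Real.exp_add]
  congr 1
  field_simp
  ring

theorem tendsto_sub_log_div (b C : ℝ) :
    Tendsto (fun n : ℕ+ => ((b - Real.log C / n : ℝ) : EReal)) atTop (𝓝 (b : EReal)) := by
  refine (continuous_coe_real_ereal.tendsto _).comp ?_
  have h : Tendsto (fun n : ℕ+ => Real.log C / (n : ℕ)) atTop (𝓝 0) :=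
    tendsto_const_nhds.div_atTop (tendsto_natCast_atTop_atTop.comp tendsto_PNat_val_atTop_atTop)
  simpa using h.const_sub b

theorem le_liminf_expRate {p : ℕ+ → ℝ≥0∞} {C : ℝ≥0} {c : ℝ}
    (h : ∀ n : ℕ+, p n ≤ C * ENNReal.ofReal (Real.exp (-(n * c)))) :
    (c : EReal) ≤ liminf (fun n => expRate n (p n)) atTop := by
  -- C may be 0; C + 1 is a positive constant, as `expRate_mul_ofReal_exp` requires.
  rw [← (tendsto_sub_log_div c (C + 1)).liminf_eq]
  refine liminf_le_liminf (Eventually.of_forall fun n => ?_)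
  rw [← expRate_mul_ofReal_exp n (by positivity)]
  refine expRate_anti n ((h n).trans ?_)
  gcongr
  rw [← ENNReal.ofReal_coe_nnreal]
  exact ENNReal.ofReal_le_ofReal (by linarith)

theorem limsup_expRate_le {p : ℕ+ → ℝ≥0∞} {C : ℝ} (hC : 0 < C) {c : ℝ}
    (h : ∀ᶠ n : ℕ+ in atTop, ENNReal.ofReal C * ENNReal.ofReal (Real.exp (-(n * c))) ≤ p n) :
    limsup (fun n => expRate n (p n)) atTop ≤ (c : EReal) := by
  rw [← (tendsto_sub_log_div c C).limsup_eq]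
  refine limsup_le_limsup ?_
  filter_upwards [h] with n hn
  rw [← expRate_mul_ofReal_exp n hC]
  exact expRate_anti n hn

end ExpRate

/-! ### Weak law of large numbers and product densities -/

section WeakLaw

variable {X : Type*} [MeasurableSpace X]

theorem infinitePi_map_fin (μ : Measure X) [IsProbabilityMeasure μ] (n : ℕ) :
    (Measure.infinitePi fun _ : ℕ => μ).map (fun ω (i : Fin n) => ω i)
      = Measure.pi fun _ : Fin n => μ := by
  rw [Measure.map_infinitePi_infinitePi_of_inj (P := fun _ : ℕ => μ) Fin.val_injective,
    Measure.infinitePi_eq_pi]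

/-- The weak law of large numbers for samples from a product measure. -/
theorem tendsto_measure_average_sub (μ : Measure X) [IsProbabilityMeasure μ] {f : X → ℝ}
    (hf : Measurable f) (hint : Integrable f μ) {ε : ℝ} (hε : 0 < ε) :
    Tendsto (fun n : ℕ => Measure.pi (fun _ : Fin n => μ)
      {x | ε ≤ |(∑ i, f (x i)) / n - ∫ y, f y ∂μ|}) atTop (𝓝 0) := by
  -- The strong law on the infinite product gives convergence in measure, an assertion about the
  -- first n coordinates alone.
  set ν := Measure.infinitePi fun _ : ℕ => μ with hν
  have hmp : ∀ i : ℕ, MeasurePreserving (fun ω : ℕ → X => ω i) ν μ := fun i =>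
    measurePreserving_eval_infinitePi (fun _ : ℕ => μ) i
  have hlaw := ProbabilityTheory.strong_law_ae_real (μ := ν) (fun i ω => f (ω i))
    ((hmp 0).integrable_comp_of_integrable hint)
    (fun i j hij => (ProbabilityTheory.iIndepFun_infinitePi (P := fun _ : ℕ => μ)
      (X := fun _ => f) fun _ => hf).indepFun hij)
    (fun i => ⟨(hf.comp (measurable_pi_apply i)).aemeasurable,
      (hf.comp (measurable_pi_apply 0)).aemeasurable, by
        change ν.map (f ∘ fun ω => ω i) = ν.map (f ∘ fun ω => ω 0)
        rw [← Measure.map_map hf (measurable_pi_apply i),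
          ← Measure.map_map hf (measurable_pi_apply 0), (hmp i).map_eq, (hmp 0).map_eq]⟩)
  have hmean : ∫ ω, f (ω 0) ∂ν = ∫ y, f y ∂μ := by
    rw [← (hmp 0).map_eq, integral_map (measurable_pi_apply 0).aemeasurable
      hf.aestronglyMeasurable]
  rw [hmean] at hlaw
  have hmeas := tendstoInMeasure_iff_norm.1 (tendstoInMeasure_of_tendsto_ae
    (fun n : ℕ => Measurable.aestronglyMeasurable (by fun_prop)) hlaw) ε hε
  refine hmeas.congr fun n => ?_
  rw [← infinitePi_map_fin, Measure.map_apply (by fun_prop)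
    (measurableSet_le measurable_const (by fun_prop))]
  congr 1
  ext ω
  simp only [mem_ofPred_eq, mem_preimage, Real.norm_eq_abs]
  rw [Fin.sum_univ_eq_sum_range (fun i => f (ω i)) n]

theorem withDensity_pi {ι : Type*} [Fintype ι] (μ : Measure X) [IsProbabilityMeasure μ]
    {f : X → ℝ≥0∞} (hf : Measurable f) [IsProbabilityMeasure (μ.withDensity f)] :
    Measure.pi (fun _ : ι => μ.withDensity f)
      = (Measure.pi fun _ : ι => μ).withDensity fun x => ∏ i, f (x i) := by
  refine Measure.pi_eq fun s hs => ?_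
  rw [withDensity_apply _ (MeasurableSet.univ_pi hs),
    ← lintegral_indicator (MeasurableSet.univ_pi hs)]
  have h : ((univ : Set ι).pi s).indicator (fun x => ∏ i, f (x i))
      = fun x => ∏ i, (s i).indicator f (x i) := by
    ext x
    by_cases hx : x ∈ (univ : Set ι).pi s
    · rw [indicator_of_mem hx]
      exact Finset.prod_congr rfl fun i _ => (indicator_of_mem (hx i (mem_univ i)) f).symm
    · rw [indicator_of_notMem hx]
      simp only [mem_univ_pi, not_forall] at hx
      obtain ⟨i, hi⟩ := hx
      exact (Finset.prod_eq_zero (Finset.mem_univ i) (indicator_of_notMem hi f)).symm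
  rw [h, lintegral_pi_prod _ fun i => hf.indicator (hs i)]
  refine Finset.prod_congr rfl fun i _ => ?_
  rw [lintegral_indicator (hs i), withDensity_apply _ (hs i)]

end WeakLaw

/-! ### Lower bound by change of measure -/

section LowerBound

variable {X : Type*} [TopologicalSpace X] [MeasurableSpace X] [BorelSpace X]

/-- Empirical measures converge weakly in probability. -/
theorem tendsto_measure_empiricalMeasure_compl (Q : ProbabilityMeasure X)
    {U : Set (ProbabilityMeasure X)} (hU : U ∈ 𝓝 Q) :
    Tendsto (fun n : ℕ+ => Measure.pi (fun _ : Fin n => (Q : Measure X))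
      (empiricalMeasure n ⁻¹' Uᶜ)) atTop (𝓝 0) := by
  -- The sets that contain the empirical measure with probability tending to 1 form a filter. Its
  -- convergence to Q can be tested on one bounded continuous function at a time, with no basis of
  -- the weak topology.
  let F : Filter (ProbabilityMeasure X) :=
    { sets := {V | Tendsto (fun n : ℕ+ => Measure.pi (fun _ : Fin n => (Q : Measure X))
        (empiricalMeasure n ⁻¹' Vᶜ)) atTop (𝓝 0)}
      univ_sets := by simp
      sets_of_superset := fun {V W} hV hVW =>
        tendsto_of_tendsto_of_tendsto_of_le_of_le tendsto_const_nhds hV (fun _ => zero_le)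
          fun n => measure_mono (preimage_mono (compl_subset_compl.2 hVW))
      inter_sets := fun {V W} hV hW => by
        have h := Tendsto.add hV hW
        rw [add_zero] at h
        refine tendsto_of_tendsto_of_tendsto_of_le_of_le tendsto_const_nhds h (fun _ => zero_le)
          fun n => ?_
        rw [compl_inter, preimage_union]
        exact measure_union_le _ _ }
  suffices h : Tendsto id F (𝓝 Q) from h hU
  rw [ProbabilityMeasure.tendsto_iff_forall_integral_tendsto]
  intro g
  rw [Metric.tendsto_nhds]
  intro ε hε
  change Tendsto _ _ _
  refine ((tendsto_measure_average_sub (Q : Measure X) g.continuous.measurable (g.integrable _)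
    hε).comp tendsto_PNat_val_atTop_atTop).congr fun n => ?_
  rw [Function.comp_apply]
  congr 1
  ext x
  simp only [mem_ofPred_eq, mem_preimage, mem_compl_iff, id, not_lt, Real.dist_eq]
  rw [integral_empiricalMeasure n x g.continuous.measurable]

/-- Tilting from P to Q: D(Q‖P) is the Q-mean of `llr`, so the event that its average is at most c
is typical under Q, and it bounds the density of the product measures. -/
theorem ofReal_mul_le_measure_of_relEntropy_ne_top {Q P : ProbabilityMeasure X}
    (hQ : relEntropy Q P ≠ ∞) {U : Set (ProbabilityMeasure X)} (hU : U ∈ 𝓝 Q)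
    {c : ℝ} (hc : (relEntropy Q P).toReal < c) :
    ∀ᶠ n : ℕ+ in atTop, ENNReal.ofReal 2⁻¹ * ENNReal.ofReal (Real.exp (-(n * c)))
      ≤ Measure.pi (fun _ : Fin n => (P : Measure X)) (empiricalMeasure n ⁻¹' U) := by
  obtain ⟨hac, hint⟩ := klDiv_ne_top_iff.1 hQ
  rw [relEntropy, toReal_klDiv_of_measure_eq hac (by simp)] at hc
  set f := (Q : Measure X).rnDeriv (P : Measure X) with hf
  have hfm : Measurable f := Measure.measurable_rnDeriv _ _
  have hQf : (P : Measure X).withDensity f = Q := Measure.withDensity_rnDeriv_eq _ _ hac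
  have hlm : Measurable (llr (Q : Measure X) (P : Measure X)) := measurable_llr _ _
  have hA := tendsto_measure_empiricalMeasure_compl Q hU
  have hB := (tendsto_measure_average_sub (Q : Measure X) hlm hint (sub_pos.2 hc)).comp
    tendsto_PNat_val_atTop_atTop
  have hAB := hA.add hB
  rw [add_zero] at hAB
  have hfin : ∀ᵐ y ∂(P : Measure X), f y < ∞ := Measure.rnDeriv_lt_top _ _
  filter_upwards [hAB.eventually_lt_const (show (0 : ℝ≥0∞) < 2⁻¹ by simp)] with n hn
  have hn0 : (0 : ℝ) < n := by exact_mod_cast n.pos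
  set V : Set (Fin n → X) := {x | (∑ i, llr (Q : Measure X) (P : Measure X) (x i)) ≤ n * c}
    with hV
  have hVm : MeasurableSet V := measurableSet_le (by fun_prop) measurable_const
  set A : Set (Fin n → X) := empiricalMeasure n ⁻¹' U with hAdef
  -- The preimage of U need not be measurable. Its hull for the P-product keeps the P-measure and
  -- allows integration of the density.
  set T := toMeasurable (Measure.pi fun _ : Fin n => (P : Measure X)) A with hT
  have hTm : MeasurableSet T := measurableSet_toMeasurable _ _
  have hcover : (univ : Set (Fin n → X)) ⊆ (T ∩ V) ∪ (empiricalMeasure n ⁻¹' Uᶜ ∪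
      {x | c - ∫ y, llr (Q : Measure X) (P : Measure X) y ∂(Q : Measure X)
        ≤ |(∑ i, llr (Q : Measure X) (P : Measure X) (x i)) / (n : ℕ)
          - ∫ y, llr (Q : Measure X) (P : Measure X) y ∂(Q : Measure X)|}) := by
    intro x _
    by_cases hxA : empiricalMeasure n x ∈ U
    · by_cases hxV : x ∈ V
      · exact Or.inl ⟨subset_toMeasurable _ _ hxA, hxV⟩
      · refine Or.inr (Or.inr ?_)
        rw [hV, mem_ofPred_eq, not_le, mul_comm, ← lt_div_iff₀ hn0] at hxV
        rw [mem_ofPred_eq]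
        exact (sub_le_sub_right hxV.le _).trans (le_abs_self _)
    · exact Or.inr (Or.inl hxA)
  have hhalf : 2⁻¹ ≤ Measure.pi (fun _ : Fin n => (Q : Measure X)) (T ∩ V) := by
    have h1 := (measure_mono hcover).trans (measure_union_le (μ := Measure.pi fun _ : Fin n =>
      (Q : Measure X)) _ _)
    rw [measure_univ] at h1
    have h2 := h1.trans (add_le_add_right ((measure_union_le _ _).trans hn.le) _)
    rw [← ENNReal.inv_two_add_inv_two] at h2
    exact (ENNReal.add_le_add_iff_right (by simp)).1 h2
  have : IsProbabilityMeasure ((P : Measure X).withDensity f) := by rw [hQf]; infer_instance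
  have hdens : Measure.pi (fun _ : Fin n => (Q : Measure X)) (T ∩ V)
      ≤ ENNReal.ofReal (Real.exp (n * c))
        * Measure.pi (fun _ : Fin n => (P : Measure X)) (T ∩ V) := by
    rw [← hQf, withDensity_pi _ hfm, withDensity_apply _ (hTm.inter hVm), ← setLIntegral_const]
    refine setLIntegral_mono_ae' (hTm.inter hVm) ?_
    have hfin' : ∀ᵐ x ∂(Measure.pi fun _ : Fin n => (P : Measure X)), ∀ i, f (x i) < ∞ :=
      ae_all_iff.2 fun i => (Measure.tendsto_eval_ae_ae (μ := fun _ : Fin n => (P : Measure X))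
        (i := i)).eventually hfin
    filter_upwards [hfin'] with x hx hxTV
    -- Since `Real.log 0 = 0`, `llr` does not represent the density where it vanishes; there the
    -- product is 0 anyway.
    by_cases h0 : ∃ i, f (x i) = 0
    · obtain ⟨i, hi⟩ := h0
      rw [Finset.prod_eq_zero (Finset.mem_univ i) hi]
      exact zero_le
    · push Not at h0
      have hprod : ∏ i, f (x i)
          = ENNReal.ofReal (Real.exp (∑ i, llr (Q : Measure X) (P : Measure X) (x i))) := by
        rw [Real.exp_sum, ENNReal.ofReal_prod_of_nonneg fun i _ => (Real.exp_pos _).le]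
        refine Finset.prod_congr rfl fun i _ => ?_
        rw [llr, Real.exp_log (ENNReal.toReal_pos (h0 i) (hx i).ne),
          ENNReal.ofReal_toReal (hx i).ne]
      rw [hprod]
      exact ENNReal.ofReal_le_ofReal (Real.exp_le_exp.2 hxTV.2)
  calc ENNReal.ofReal 2⁻¹ * ENNReal.ofReal (Real.exp (-(n * c)))
      ≤ ENNReal.ofReal (Real.exp (n * c))
          * Measure.pi (fun _ : Fin n => (P : Measure X)) (T ∩ V)
          * ENNReal.ofReal (Real.exp (-(n * c))) := by
        gcongr
        refine le_trans (le_of_eq ?_) (hhalf.trans hdens)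
        rw [ENNReal.ofReal_inv_of_pos two_pos]
        simp
    _ = Measure.pi (fun _ : Fin n => (P : Measure X)) (T ∩ V) := by
        rw [mul_right_comm, ← ENNReal.ofReal_mul (Real.exp_pos _).le, ← Real.exp_add]
        simp
    _ ≤ Measure.pi (fun _ : Fin n => (P : Measure X)) A :=
        (measure_mono inter_subset_left).trans_eq (measure_toMeasurable _)

end LowerBound

/-! ### Assembly of the large deviation principle -/

theorem satisfiesLDP_empiricalLaw {X : Type*} [TopologicalSpace X] [PolishSpace X]
    [MeasurableSpace X] [BorelSpace X] (P : ProbabilityMeasure X) :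
    SatisfiesLDP (empiricalLaw P) (fun Q => relEntropy Q P) := by
  intro Γ hΓ
  simp only [empiricalLaw_apply P _ hΓ]
  refine ⟨?_, liminf_le_limsup, ?_⟩
  · refine EReal.ge_of_forall_gt_iff_ge.1 fun c hc => ?_
    obtain ⟨C, hC⟩ := exists_measure_empiricalMeasure_le P (isClosed_closure (s := Γ)) (c := c)
      fun Q hQ => hc.trans_le (iInf₂_le Q hQ)
    exact le_liminf_expRate fun n =>
      (measure_mono (preimage_mono subset_closure)).trans (hC n)
  · refine le_iInf₂ fun Q hQ => ?_
    by_cases h : relEntropy Q P = ∞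
    · simp [h]
    refine EReal.le_of_forall_lt_iff_le.1 fun c hc => ?_
    rw [← ENNReal.ofReal_toReal h, EReal.coe_ennreal_ofReal,
      max_eq_left ENNReal.toReal_nonneg, EReal.coe_lt_coe_iff] at hc
    exact limsup_expRate_le (by norm_num) (ofReal_mul_le_measure_of_relEntropy_ne_top h
      (mem_interior_iff_mem_nhds.1 hQ) hc)

end Sanov

theorem mainTheorem2 {X : Type*} [TopologicalSpace X] [PolishSpace X] [MeasurableSpace X]
    [BorelSpace X] (P : ProbabilityMeasure X) :
    Sanov.SatisfiesLDP (Sanov.empiricalLaw P) (fun Q => Sanov.relEntropy Q P) ∧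
      Sanov.IsGoodRateFunction (fun Q : ProbabilityMeasure X => Sanov.relEntropy Q P) ∧
      Sanov.IsConvexOnProbabilityMeasures (fun Q => Sanov.relEntropy Q P) :=
  ⟨Sanov.satisfiesLDP_empiricalLaw P,
    ⟨Sanov.lowerSemicontinuous_relEntropy P, Sanov.isCompact_relEntropy_le P⟩,
    Sanov.isConvexOnProbabilityMeasures_relEntropy P⟩
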